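/- Let $\Gamma$ be a finite connected simplicial graph with vertex set $V$, and let $A_\Gamma$ be the associated right-angled Artin group: it is generated by $V$, subject to the relations that adjacent vertices commute. For a set $S$ of vertices, $A_S$ denotes the right-angled Artin group of the full subgraph spanned by $S$. Write $lk(v)$ for the set of neighbours of $v$ and $st(v)=lk(v)\cup\{v\}$. Put $v\le w$ if $lk(v)\subseteq st(w)$, and $v\sim w$ if $v\le w$ and $w\le v$; then $\sim$ is an equivalence relation and $\le$ induces a partial order on the set of classes $[v]$. Let $\Gamma_0$ be the graph whose vertices are the maximal classes (two of them being joined by an edge if their representatives are adjacent in $\Gamma$), and put $L_{[v]}=lk(v)\setminus[v]$. For $u\le w$ with $u\ne w$ let $t(u,w)$ be the transvection, that is, the automorphism of $A_\Gamma$ that sends $u\mapsto uw$ and fixes all other vertices; its class in $Out(A_\Gamma)$ is denoted by the same symbol. Then $\Gamma_0$ consists of a single vertex if and only if $A_\Gamma$ has nontrivial center. Suppose that $\Gamma_0$ consists of a single vertex $[v]$. Then $A_{[v]}$ is free abelian with basis $[v]$, the subgroup $Tr$ of $Out(A_\Gamma)$ generated by the transvections $t(u,w)$ with $u\in L_{[v]}$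 and $w\in[v]$ is free abelian with these transvections as a basis, and $$Out(A_\Gamma)\;\cong\; Tr\rtimes\bigl(GL(A_{[v]})\times Out(A_{L_{[v]}})\bigr),$$ where $GL(A_{[v]})=Aut(A_{[v]})$. Here the isomorphism is the inclusion on $Tr$, and it sends $(\alpha,[\beta])\in GL(A_{[v]})\times Out(A_{L_{[v]}})$ to the class of an automorphism of $A_\Gamma$ that restricts to $\alpha$ on $A_{[v]}$ and to $\beta$ on $A_{L_{[v]}}$. -/

import Mathlib

/-! ### Right-angled Artin groups -/

/-- The defining relators of the right-angled Artin group of `Γ`: one commutator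
`[u, w]` for every edge `uw` of `Γ`. -/
def raagRels {V : Type*} (Γ : SimpleGraph V) : Set (FreeGroup V) :=
  {r | ∃ u w : V, Γ.Adj u w ∧
    r = FreeGroup.of u * FreeGroup.of w * (FreeGroup.of u)⁻¹ * (FreeGroup.of w)⁻¹}

/-- The right-angled Artin group `A_Γ`. -/
abbrev RAAG {V : Type*} (Γ : SimpleGraph V) : Type _ := PresentedGroup (raagRels Γ)

namespace RAAG

variable {V : Type*} (Γ : SimpleGraph V)

/-- The standard generator of `A_Γ` given by a vertex. -/
def gen (v : V) : RAAG Γ := PresentedGroup.of v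

theorem gen_commute {u w : V} (h : Γ.Adj u w) : gen Γ u * gen Γ w = gen Γ w * gen Γ u := by
  have h1 := PresentedGroup.one_of_mem (rels := raagRels Γ) ⟨u, w, h, rfl⟩
  simp only [map_mul, map_inv] at h1
  refine mul_inv_eq_one.mp ?_
  rw [mul_inv_rev, ← mul_assoc]
  exact h1

variable {Γ}

/-- The homomorphism `A_Γ → G` extending a map on vertices that sends adjacent vertices to
commuting elements. -/
def lift {G : Type*} [Group G] (f : V → G) (hf : ∀ u w, Γ.Adj u w → f u * f w = f w * f u) :
    RAAG Γ →* G :=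
  PresentedGroup.toGroup (f := f) (rels := raagRels Γ) (by
    rintro r ⟨u, w, h, rfl⟩
    simp only [map_mul, map_inv, FreeGroup.lift_apply_of]
    rw [hf u w h]
    group)

@[simp]
theorem lift_gen {G : Type*} [Group G] (f : V → G)
    (hf : ∀ u w, Γ.Adj u w → f u * f w = f w * f u) (v : V) : lift f hf (gen Γ v) = f v :=
  PresentedGroup.toGroup.of _

theorem hom_ext {G : Type*} [Group G] {f g : RAAG Γ →* G}
    (h : ∀ v, f (gen Γ v) = g (gen Γ v)) : f = g :=
  PresentedGroup.ext h

variable (Γ)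

/-- The canonical homomorphism `A_S → A_Γ` for the full subgraph spanned by a set `S` of
vertices. -/
def incl (S : Set V) : RAAG (Γ.induce S) →* RAAG Γ :=
  lift (fun s => gen Γ s) fun u w h => gen_commute Γ (u := u) (w := w) h

end RAAG

/-! ### Outer automorphisms -/

instance innNormal (G : Type*) [Group G] : (MulAut.conj : G →* MulAut G).range.Normal where
  conj_mem := by
    rintro _ ⟨g, rfl⟩ a
    refine ⟨a g, ?_⟩
    ext x
    simp [MulAut.mul_apply, MulAut.conj_apply]

/-- The outer automorphism group `Out(G) = Aut(G) / Inn(G)`. -/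
abbrev Out (G : Type*) [Group G] : Type _ := MulAut G ⧸ (MulAut.conj : G →* MulAut G).range

/-- The projection `Aut(G) → Out(G)`. -/
def Out.mk (G : Type*) [Group G] : MulAut G →* Out G :=
  QuotientGroup.mk' (MulAut.conj : G →* MulAut G).range

/-- `G` is a free abelian group with basis the family `b`. -/
def IsFreeAbelianOn {ι G : Type*} [Group G] (b : ι → G) : Prop :=
  ∃ e : G ≃* Multiplicative (ι →₀ ℤ), ∀ i, e (b i) = Multiplicative.ofAdd (Finsupp.single i 1)

/-! ### The order on vertices, their classes, and the vertices of `Γ₀` -/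

section Order

variable {V : Type*} (Γ : SimpleGraph V)

/-- The (closed) star of a vertex. -/
def closedStar (v : V) : Set V := insert v (Γ.neighborSet v)

/-- `v ≤ w` if `lk(v) ⊆ st(w)`. -/
def DomLE (v w : V) : Prop := Γ.neighborSet v ⊆ closedStar Γ w

variable {Γ}

theorem DomLE.refl (v : V) : DomLE Γ v v := Set.subset_insert _ _

theorem DomLE.trans {u v w : V} (h1 : DomLE Γ u v) (h2 : DomLE Γ v w) : DomLE Γ u w := by
  intro x hx
  have hux : Γ.Adj u x := hx
  rcases h1 hx with hxv | hxv
  · subst hxv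
    rcases h2 hux.symm with huw | hwu
    · subst huw
      exact Or.inr hux
    · have hwu' : Γ.Adj w u := hwu
      rcases h1 hwu'.symm with hwx | hxw
      · exact Or.inl hwx.symm
      · exact Or.inr (SimpleGraph.Adj.symm hxw)
  · exact h2 hxv

variable (Γ)

/-- `v ∼ w` if `v ≤ w` and `w ≤ v`. -/
def vertexSetoid : Setoid V where
  r v w := DomLE Γ v w ∧ DomLE Γ w v
  iseqv :=
    ⟨fun v => ⟨DomLE.refl v, DomLE.refl v⟩, fun h => ⟨h.2, h.1⟩,
      fun h k => ⟨h.1.trans k.1, k.2.trans h.2⟩⟩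

/-- The set of equivalence classes of vertices. -/
def VertexClass : Type _ := Quotient (vertexSetoid Γ)

/-- The equivalence class `[v]`, as an element of the set of classes. -/
def vertexClass (v : V) : VertexClass Γ := Quotient.mk (vertexSetoid Γ) v

/-- The partial order on classes induced by `≤` on vertices. -/
instance : PartialOrder (VertexClass Γ) where
  le := Quotient.lift₂ (DomLE Γ) fun _ _ _ _ h k =>
    propext ⟨fun l => (h.2.trans l).trans k.1, fun l => (h.1.trans l).trans k.2⟩
  le_refl := by rintro ⟨a⟩; exact DomLE.refl a
  le_trans := by rintro ⟨a⟩ ⟨b⟩ ⟨c⟩ h k; exact DomLE.trans h k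
  le_antisymm := by rintro ⟨a⟩ ⟨b⟩ h k; exact Quotient.sound ⟨h, k⟩

/-- The vertex set of `Γ₀`: the maximal equivalence classes. -/
def gammaZeroVertices : Set (VertexClass Γ) := {c | IsMax c}

/-- The equivalence class `[v]`, as a set of vertices of `Γ`. -/
def classSet (v : V) : Set V := {w | vertexClass Γ w = vertexClass Γ v}

/-- `L_[v] = lk(v) ∖ [v]`. -/
def linkSet (v : V) : Set V := Γ.neighborSet v \ classSet Γ v

theorem domLE_of_gammaZero [Finite V] {v : V} (hv : gammaZeroVertices Γ = {vertexClass Γ v})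
    (u : V) {w : V} (hw : w ∈ classSet Γ v) : DomLE Γ u w := by
  have : Finite (VertexClass Γ) := Quotient.finite _
  obtain ⟨c, hc, hmax⟩ := Set.finite_univ.exists_le_maximal (Set.mem_univ (vertexClass Γ u))
  have hcm : c ∈ gammaZeroVertices Γ := fun b hb => hmax.2 (Set.mem_univ b) hb
  rw [hv, Set.mem_singleton_iff] at hcm
  have hw' : vertexClass Γ w = vertexClass Γ v := hw
  rw [hcm, ← hw'] at hc
  exact hc

end Order

/-! ### Transvections -/

section Transvection

variable {V : Type*} {Γ : SimpleGraph V}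

open Classical in
/-- For `u ≤ w`, `u ≠ w` and an integer `n`, the endomorphism of `A_Γ` sending `u` to `u wⁿ` and
fixing the other generators. -/
noncomputable def transvectionHom {u w : V} (h : DomLE Γ u w) (n : ℤ) : RAAG Γ →* RAAG Γ :=
  RAAG.lift (fun x => if x = u then RAAG.gen Γ u * RAAG.gen Γ w ^ n else RAAG.gen Γ x) (by
    have key : ∀ x, Γ.Adj u x → Commute (RAAG.gen Γ u * RAAG.gen Γ w ^ n) (RAAG.gen Γ x) := by
      intro x hx
      refine Commute.mul_left (RAAG.gen_commute Γ hx) (Commute.zpow_left ?_ n)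
      rcases h hx with rfl | hwx
      · exact Commute.refl _
      · exact RAAG.gen_commute Γ hwx
    intro x y hxy
    by_cases hx : x = u
    · subst hx
      rw [if_pos rfl, if_neg hxy.ne']
      exact key y hxy
    · by_cases hy : y = u
      · subst hy
        rw [if_pos rfl, if_neg hx]
        exact (key x hxy.symm).symm
      · rw [if_neg hx, if_neg hy]
        exact RAAG.gen_commute Γ hxy)

theorem transvectionHom_comp {u w : V} (h : DomLE Γ u w) (hne : u ≠ w) (m n : ℤ)
    (hmn : n + m = 0) :
    (transvectionHom h m).comp (transvectionHom h n) = MonoidHom.id (RAAG Γ) := by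
  apply RAAG.hom_ext
  intro x
  by_cases hx : x = u
  · subst hx
    simp [transvectionHom, hne.symm, mul_assoc, ← zpow_add, add_comm m n, hmn]
  · simp [transvectionHom, hx]

/-- The transvection `t(u,w)`, for `u ≤ w` and `u ≠ w`: the automorphism of `A_Γ` sending `u` to
`u w` and fixing all other generators. -/
noncomputable def transvection {u w : V} (h : DomLE Γ u w) (hne : u ≠ w) : MulAut (RAAG Γ) :=
  MonoidHom.toMulEquiv (transvectionHom h 1) (transvectionHom h (-1))
    (transvectionHom_comp h hne _ _ (by norm_num))
    (transvectionHom_comp h hne _ _ (by norm_num))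

theorem transvection_gen_self {u w : V} (h : DomLE Γ u w) (hne : u ≠ w) :
    transvection h hne (RAAG.gen Γ u) = RAAG.gen Γ u * RAAG.gen Γ w := by
  simp [transvection, transvectionHom]

theorem transvection_gen_of_ne {u w : V} (h : DomLE Γ u w) (hne : u ≠ w) {x : V} (hx : x ≠ u) :
    transvection h hne (RAAG.gen Γ x) = RAAG.gen Γ x := by
  simp [transvection, transvectionHom, hx]

/-- When `Γ₀` is the single vertex `[v]`: the class in `Out(A_Γ)` of the transvection `t(u,w)`,
for `u ∈ L_[v]` and `w ∈ [v]`. -/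
noncomputable def leafTransvection [Finite V] {v : V}
    (hv : gammaZeroVertices Γ = {vertexClass Γ v}) (p : linkSet Γ v × classSet Γ v) :
    Out (RAAG Γ) :=
  Out.mk _ (transvection (domLE_of_gammaZero Γ hv p.1 p.2.2) fun h => p.1.2.2 (h ▸ p.2.2))

/-- The subgroup `Tr` of `Out(A_Γ)` generated by the leaf transvections. -/
noncomputable def Tr [Finite V] {v : V} (hv : gammaZeroVertices Γ = {vertexClass Γ v}) :
    Subgroup (Out (RAAG Γ)) :=
  Subgroup.closure (Set.range (leafTransvection hv))

/-- The leaf transvections, as elements of `Tr`. -/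
noncomputable def Tr.gen [Finite V] {v : V} (hv : gammaZeroVertices Γ = {vertexClass Γ v})
    (p : linkSet Γ v × classSet Γ v) : Tr hv :=
  ⟨leafTransvection hv p, Subgroup.subset_closure ⟨p, rfl⟩⟩

end Transvection

/-! If `Γ₀` is the single vertex `[v]`, connectedness makes `[v]` exactly the set of cone vertices
of `Γ`. Hence `A_Γ = Z × H` with `Z = A_[v]` free abelian and `H = A_L`, and the graph on `L` has no
cone vertex.

The main point is that such an `H` has trivial center (`center_eq_bot`). If `y ≠ x` is not adjacent
to `x`, map `A_Γ` to `F ⋊ A_Γ`, with `F` free on the cosets of the subgroup generated by `lk(x)`, by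
sending `x` to the trivial coset. This map has a left inverse. The free part of a central element
commutes with two distinct basis elements, so it is trivial, and the element survives killing `x`.
Killing every vertex in turn leaves only `1`.

An automorphism of `Z × H` then preserves the center `Z`, so it is block triangular: a shear by some
`f : H → Z` after a product automorphism (`mulAut_eq_shear_mul_prodAut`). Inner automorphisms come
from `H` alone, so `Out(Z × H) = Hom(H, Z) ⋊ (Aut Z × Out H)`. Finally, `Hom(H, Z)` is free abelian
on the maps sending one vertex of `L` to one vertex of `[v]` and the others to `1`; their shears are
the transvections generating `Tr`. -/

/-! ### Centers of right-angled Artin groups -/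

/-- An element of a free group whose reduced word does not begin with the letter `c^{±1}`, and which
commutes with `c`, is trivial. -/
theorem FreeGroup.eq_one_of_commute_of_ne {α : Type*} [DecidableEq α] {f : FreeGroup α} {c : α}
    (hc : Commute f (FreeGroup.of c)) (hf : ∀ p ∈ f.toWord.head?, p.1 ≠ c) : f = 1 := by
  rw [← FreeGroup.toWord_eq_nil_iff]
  rcases hw : f.toWord with _ | ⟨p, l⟩
  · rfl
  exfalso
  have hpc : p.1 ≠ c := hf p (by rw [hw]; rfl)
  have hred : FreeGroup.IsReduced ((c, true) :: p :: l) := by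
    rw [FreeGroup.isReduced_cons_cons]
    exact ⟨fun h => absurd h.symm hpc, hw ▸ FreeGroup.isReduced_toWord⟩
  have h1 : (FreeGroup.of c * f).toWord = (c, true) :: p :: l := by
    rw [FreeGroup.toWord_mul, hw, FreeGroup.toWord_of]
    exact hred.reduce_eq
  -- The word of `c f = f c` is a sublist of `f.toWord ++ [c]` of the same length, so the two agree;
  -- their first letters do not.
  have h2 := FreeGroup.toWord_mul_sublist f (FreeGroup.of c)
  rw [hc.eq, h1, hw, FreeGroup.toWord_of] at h2
  have h3 := h2.eq_of_length (by simp)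
  simp only [List.cons_append, List.cons.injEq] at h3
  exact hpc (by rw [← h3.1])

/-- A reduced word has only one first letter, so it fails to begin with at least one of `a^{±1}`,
`b^{±1}`. -/
theorem FreeGroup.eq_one_of_commute_of {α : Type*} {f : FreeGroup α} {a b : α} (hab : a ≠ b)
    (ha : Commute f (FreeGroup.of a)) (hb : Commute f (FreeGroup.of b)) : f = 1 := by
  classical
  by_cases h : ∀ p ∈ f.toWord.head?, p.1 ≠ a
  · exact FreeGroup.eq_one_of_commute_of_ne ha h
  · push Not at h
    obtain ⟨p, hp, hpa⟩ := h
    refine FreeGroup.eq_one_of_commute_of_ne hb fun q hq => ?_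
    rw [Option.mem_unique hq hp, hpa]
    exact hab

theorem FreeGroup.eq_of_conj_of {α : Type*} {f : FreeGroup α} {a b : α}
    (h : f * FreeGroup.of a * f⁻¹ = FreeGroup.of b) : a = b := by
  let F : FreeGroup α →* Multiplicative (α →₀ ℤ) :=
    FreeGroup.lift fun x => Multiplicative.ofAdd (Finsupp.single x 1)
  have hF : ∀ x, F (FreeGroup.of x) = Multiplicative.ofAdd (Finsupp.single x 1) := fun x =>
    FreeGroup.lift_apply_of
  have h' := congrArg F h
  rw [_root_.map_mul, _root_.map_mul, _root_.map_inv, mul_inv_cancel_comm, hF, hF] at h'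
  exact Finsupp.single_left_injective one_ne_zero (Multiplicative.ofAdd.injective h')

namespace FreeGroup

/-- The action of a group on the free group over a set on which it acts. -/
def permAction (G α : Type*) [Group G] [MulAction G α] : G →* MulAut (FreeGroup α) where
  toFun g := FreeGroup.freeGroupCongr (MulAction.toPerm g)
  map_one' := MulEquiv.toMonoidHom_injective <| FreeGroup.ext_hom _ _ fun x => by
    simp [FreeGroup.freeGroupCongr]
  map_mul' g h := MulEquiv.toMonoidHom_injective <| FreeGroup.ext_hom _ _ fun x => by
    simp [FreeGroup.freeGroupCongr, mul_smul]

@[simp]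
theorem permAction_of {G α : Type*} [Group G] [MulAction G α] (g : G) (a : α) :
    permAction G α g (FreeGroup.of a) = FreeGroup.of (g • a) := by
  simp [permAction, FreeGroup.freeGroupCongr]

end FreeGroup

namespace RAAG

variable {V : Type*} (Γ : SimpleGraph V)

theorem closure_range_gen : Subgroup.closure (Set.range (gen Γ)) = ⊤ :=
  PresentedGroup.closure_range_of _

open Classical in
/-- The endomorphism of `A_Γ` that kills the vertices in `S` and fixes all others. -/
noncomputable def kill (S : Set V) : RAAG Γ →* RAAG Γ :=
  lift (fun v => if v ∈ S then 1 else gen Γ v) fun u w h => by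
    have := gen_commute Γ h
    by_cases hu : u ∈ S <;> by_cases hw : w ∈ S <;> simp [hu, hw, this]

theorem kill_gen_of_mem {S : Set V} {v : V} (h : v ∈ S) : kill Γ S (gen Γ v) = 1 := by
  simp [kill, h]

theorem kill_gen_of_notMem {S : Set V} {v : V} (h : v ∉ S) : kill Γ S (gen Γ v) = gen Γ v := by
  simp [kill, h]

/-- The exponent sum of each generator. -/
noncomputable def exponents : RAAG Γ →* Multiplicative (V →₀ ℤ) :=
  lift (fun v => Multiplicative.ofAdd (Finsupp.single v 1)) fun _ _ _ => mul_comm _ _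

@[simp]
theorem exponents_gen (v : V) :
    exponents Γ (gen Γ v) = Multiplicative.ofAdd (Finsupp.single v 1) := by
  simp [exponents]

theorem gen_ne_one (v : V) : gen Γ v ≠ 1 := by
  intro h
  have h' := congrArg (exponents Γ) h
  rw [exponents_gen, map_one, ← ofAdd_zero] at h'
  simpa using Multiplicative.ofAdd.injective h'

/-- The subgroup generated by the link of a vertex. -/
def linkSubgroup (x : V) : Subgroup (RAAG Γ) := Subgroup.closure (gen Γ '' Γ.neighborSet x)

/-- Killing the link of `x` kills the whole subgroup but not `y`. This separates the coset of `y`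
from the trivial coset. -/
theorem gen_notMem_linkSubgroup {x y : V} (h : ¬ Γ.Adj x y) : gen Γ y ∉ linkSubgroup Γ x := by
  intro hy
  have hle : linkSubgroup Γ x ≤ (kill Γ (Γ.neighborSet x)).ker := by
    refine (Subgroup.closure_le _).2 ?_
    rintro _ ⟨u, hu, rfl⟩
    exact kill_gen_of_mem Γ hu
  have := hle hy
  rw [MonoidHom.mem_ker, kill_gen_of_notMem Γ (by exact h)] at this
  exact gen_ne_one Γ y this

theorem commute_gen_of_mem_linkSubgroup {x : V} {c : RAAG Γ} (hc : c ∈ linkSubgroup Γ x) :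
    Commute c (gen Γ x) := by
  have hle : linkSubgroup Γ x ≤ Subgroup.centralizer {gen Γ x} := by
    refine (Subgroup.closure_le _).2 ?_
    rintro _ ⟨u, hu, rfl⟩
    exact Subgroup.mem_centralizer_singleton_iff.2 (gen_commute Γ hu.symm)
  exact Subgroup.mem_centralizer_singleton_iff.1 (hle hc)

/-- The free group over the cosets of the link subgroup, extended by `A_Γ`. -/
abbrev LinkExtension (x : V) : Type _ :=
  FreeGroup (RAAG Γ ⧸ linkSubgroup Γ x) ⋊[FreeGroup.permAction (RAAG Γ) _] RAAG Γ

open Classical in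
/-- The homomorphism that sends `x` to the trivial coset and any other vertex to itself. -/
noncomputable def toLinkExtension (x : V) : RAAG Γ →* LinkExtension Γ x :=
  lift (fun v => if v = x then SemidirectProduct.inl (FreeGroup.of ((1 : RAAG Γ) : RAAG Γ ⧸ _))
      else SemidirectProduct.inr (gen Γ v)) (by
    have key : ∀ y, Γ.Adj x y →
        (SemidirectProduct.inl (FreeGroup.of ((1 : RAAG Γ) : RAAG Γ ⧸ _)) : LinkExtension Γ x) *
          SemidirectProduct.inr (gen Γ y) =
        SemidirectProduct.inr (gen Γ y) *
          SemidirectProduct.inl (FreeGroup.of ((1 : RAAG Γ) : RAAG Γ ⧸ _)) := by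
      intro y hy
      -- A neighbour `y` of `x` fixes the trivial coset, so it commutes with the corresponding free
      -- generator.
      have h1 : ((gen Γ y : RAAG Γ) : RAAG Γ ⧸ linkSubgroup Γ x) = ((1 : RAAG Γ) : RAAG Γ ⧸ _) := by
        rw [eq_comm, QuotientGroup.eq, inv_one, one_mul]
        exact Subgroup.subset_closure ⟨y, hy, rfl⟩
      ext1
      · simp [h1, -QuotientGroup.mk_one]
      · simp
    intro u w h
    by_cases hu : u = x
    · subst hu
      rw [if_pos rfl, if_neg h.ne']
      exact key w h
    · by_cases hw : w = x
      · subst hw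
        rw [if_pos rfl, if_neg hu]
        exact (key u h.symm).symm
      · rw [if_neg hu, if_neg hw, ← map_mul, gen_commute Γ h, map_mul])

/-- The homomorphism that sends the coset of `a` to `a x a⁻¹`. -/
noncomputable def ofLinkExtension (x : V) : LinkExtension Γ x →* RAAG Γ :=
  SemidirectProduct.lift
    (FreeGroup.lift fun q => Quotient.liftOn' q (fun a => a * gen Γ x * a⁻¹) (by
      intro a b hab
      rw [QuotientGroup.leftRel_apply] at hab
      have h := (commute_gen_of_mem_linkSubgroup Γ hab).eq
      have hb : b = a * (a⁻¹ * b) := by group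
      change a * gen Γ x * a⁻¹ = b * gen Γ x * b⁻¹
      rw [hb, mul_assoc a _ (gen Γ x), h]
      group))
    (MonoidHom.id _) (by
      intro g
      ext q
      induction q using QuotientGroup.induction_on with
      | H a =>
        simp only [MonoidHom.comp_apply, MulEquiv.coe_toMonoidHom, FreeGroup.permAction_of,
          FreeGroup.lift_apply_of, MulAction.Quotient.smul_coe, MulAut.conj_apply,
          MonoidHom.id_apply]
        change (g * a) * gen Γ x * (g * a)⁻¹ = g * (a * gen Γ x * a⁻¹) * g⁻¹
        group)

theorem ofLinkExtension_toLinkExtension (x : V) (a : RAAG Γ) :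
    ofLinkExtension Γ x (toLinkExtension Γ x a) = a := by
  suffices h : (ofLinkExtension Γ x).comp (toLinkExtension Γ x) = MonoidHom.id _ from
    DFunLike.congr_fun h a
  apply hom_ext
  intro v
  by_cases hv : v = x
  · subst hv
    simp only [toLinkExtension, ofLinkExtension, MonoidHom.comp_apply, lift_gen, if_true,
      SemidirectProduct.lift_inl, FreeGroup.lift_apply_of]
    change 1 * gen Γ v * 1⁻¹ = gen Γ v
    group
  · simp [toLinkExtension, ofLinkExtension, hv]

theorem toLinkExtension_right (x : V) (a : RAAG Γ) :
    (toLinkExtension Γ x a).right = kill Γ {x} a := by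
  suffices h : SemidirectProduct.rightHom.comp (toLinkExtension Γ x) = kill Γ {x} from
    DFunLike.congr_fun h a
  apply hom_ext
  intro v
  by_cases hv : v = x <;> simp [toLinkExtension, kill, hv]

/-- Puts a second free generator in the image, so that images of central elements commute with it
too. -/
theorem toLinkExtension_conj {x y : V} (hne : y ≠ x) :
    toLinkExtension Γ x (gen Γ y * gen Γ x * (gen Γ y)⁻¹) =
      SemidirectProduct.inl (FreeGroup.of ((gen Γ y : RAAG Γ) : RAAG Γ ⧸ _)) := by
  rw [map_mul, map_mul, map_inv]
  simp only [toLinkExtension, lift_gen, if_neg hne, if_true]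
  rw [← map_inv, ← SemidirectProduct.inl_aut, FreeGroup.permAction_of,
    MulAction.Quotient.smul_coe, smul_eq_mul, mul_one]

/-- A central element does not involve any vertex that is not a cone vertex. -/
theorem kill_eq_self_of_mem_center {x y : V} (hne : y ≠ x) (hxy : ¬ Γ.Adj x y) {z : RAAG Γ}
    (hz : z ∈ Subgroup.center (RAAG Γ)) : kill Γ {x} z = z := by
  rw [Subgroup.mem_center_iff] at hz
  set p := toLinkExtension Γ x z with hp
  have key : ∀ q : RAAG Γ ⧸ linkSubgroup Γ x,
      p * SemidirectProduct.inl (FreeGroup.of q) = SemidirectProduct.inl (FreeGroup.of q) * p →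
      Commute p.left (FreeGroup.of q) := by
    intro q hq
    have h1 := congrArg SemidirectProduct.left hq
    simp only [SemidirectProduct.mul_left, SemidirectProduct.left_inl,
      SemidirectProduct.right_inl, map_one, MulAut.one_apply, FreeGroup.permAction_of] at h1
    have h2 : p.right • q = q := by
      -- The left components give `p.left * (p.right • q) * p.left⁻¹ = q` in the free group;
      -- conjugate basis elements coincide.
      refine FreeGroup.eq_of_conj_of (f := p.left) ?_
      rw [h1, mul_inv_cancel_right]
    rw [h2] at h1
    exact h1
  have h1 : Commute p.left (FreeGroup.of ((1 : RAAG Γ) : RAAG Γ ⧸ linkSubgroup Γ x)) := by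
    apply key
    have : toLinkExtension Γ x (gen Γ x) =
        SemidirectProduct.inl (FreeGroup.of ((1 : RAAG Γ) : RAAG Γ ⧸ linkSubgroup Γ x)) := by
      simp only [toLinkExtension, lift_gen, if_true]
    rw [← this, hp, ← map_mul, ← map_mul, hz]
  have h2 : Commute p.left (FreeGroup.of ((gen Γ y : RAAG Γ) : RAAG Γ ⧸ linkSubgroup Γ x)) := by
    apply key
    rw [← toLinkExtension_conj Γ hne, hp, ← map_mul, ← map_mul, hz]
  have h3 : p.left = 1 := by
    refine FreeGroup.eq_one_of_commute_of ?_ h1 h2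
    intro h
    rw [QuotientGroup.eq, inv_one, one_mul] at h
    exact gen_notMem_linkSubgroup Γ hxy h
  -- With trivial free part, `p` is its right component, on which the left inverse is the identity.
  have h4 : p = SemidirectProduct.inr (kill Γ {x} z) := by
    ext1
    · simp [h3]
    · rw [SemidirectProduct.right_inr, ← toLinkExtension_right]
  have h5 := ofLinkExtension_toLinkExtension Γ x z
  rw [← hp, h4, ofLinkExtension, SemidirectProduct.lift_inr] at h5
  exact h5

theorem kill_comp_kill (S T : Set V) : (kill Γ S).comp (kill Γ T) = kill Γ (S ∪ T) := by
  apply hom_ext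
  intro v
  by_cases hS : v ∈ S <;> by_cases hT : v ∈ T <;> simp [kill, hS, hT]

/-- The right-angled Artin group of a finite graph without cone vertices has trivial center. -/
theorem center_eq_bot [Finite V] (h : ∀ x, ∃ y, y ≠ x ∧ ¬ Γ.Adj x y) :
    Subgroup.center (RAAG Γ) = ⊥ := by
  rw [Subgroup.eq_bot_iff_forall]
  intro z hz
  have hfix : ∀ S : Set V, S.Finite → kill Γ S z = z := by
    intro S hS
    induction S, hS using Set.Finite.induction_on with
    | empty =>
      have : kill Γ (∅ : Set V) = MonoidHom.id _ := hom_ext fun v => by simp [kill]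
      rw [this, MonoidHom.id_apply]
    | @insert x S _ _ ih =>
      obtain ⟨y, hy, hxy⟩ := h x
      rw [Set.insert_eq, ← kill_comp_kill, MonoidHom.comp_apply, ih,
        kill_eq_self_of_mem_center Γ hy hxy hz]
  have h1 : kill Γ (Set.univ : Set V) = 1 := hom_ext fun v => by simp [kill]
  rw [← hfix Set.univ Set.finite_univ, h1, MonoidHom.one_apply]

end RAAG

/-! ### Automorphisms of the product of an abelian group and a centerless group -/

section ProductAut

variable {Z H : Type*} [CommGroup Z] [Group H]

/-- The automorphism `(z, h) ↦ (f h * z, h)` given by a homomorphism `f : H → Z`. -/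
def shear : (H →* Z) →* MulAut (Z × H) where
  toFun f :=
    { toFun := fun p => (f p.2 * p.1, p.2)
      invFun := fun p => ((f p.2)⁻¹ * p.1, p.2)
      left_inv := fun p => by simp
      right_inv := fun p => by simp
      map_mul' := fun p q => by simp [mul_mul_mul_comm] }
  map_one' := by ext p <;> simp
  map_mul' f g := by ext p <;> simp [mul_assoc]

@[simp]
theorem shear_apply (f : H →* Z) (p : Z × H) : shear f p = (f p.2 * p.1, p.2) := rfl

/-- The product of two automorphisms. -/
def prodAut (Z H : Type*) [Group Z] [Group H] : MulAut Z × MulAut H →* MulAut (Z × H) where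
  toFun a := MulEquiv.prodCongr a.1 a.2
  map_one' := rfl
  map_mul' _ _ := rfl

@[simp]
theorem prodAut_apply {Z H : Type*} [Group Z] [Group H] (a : MulAut Z × MulAut H) (p : Z × H) :
    prodAut Z H a p = (a.1 p.1, a.2 p.2) := rfl

theorem prodAut_conj_shear (a : MulAut Z × MulAut H) (f : H →* Z) :
    prodAut Z H a * shear f * (prodAut Z H a)⁻¹ =
      shear ((a.1.toMonoidHom.comp f).comp (a.2⁻¹ : MulAut H).toMonoidHom) := by
  rw [mul_inv_eq_iff_eq_mul]
  ext p <;> simp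

/-- Conjugation in `Z × H` fixes the `Z`-coordinate, and on `H` it depends only on `b.2`. -/
theorem shear_mul_prodAut_eq_conj {f : H →* Z} {a : MulAut Z × MulAut H} {b : Z × H}
    (h : shear f * prodAut Z H a = MulAut.conj b) : f = 1 ∧ a.1 = 1 ∧ a.2 = MulAut.conj b.2 := by
  have h' : ∀ z x, f (a.2 x) * a.1 z = z ∧ a.2 x = b.2 * x * b.2⁻¹ := by
    intro z x
    have := DFunLike.congr_fun h (z, x)
    simp only [MulAut.mul_apply, prodAut_apply, shear_apply, MulAut.conj_apply, Prod.ext_iff,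
      Prod.fst_mul, Prod.snd_mul, Prod.fst_inv, Prod.snd_inv, mul_inv_cancel_comm] at this
    exact this
  refine ⟨?_, ?_, ?_⟩
  · ext x
    simpa using (h' 1 (a.2⁻¹ x)).1
  · ext z
    simpa using (h' z 1).1
  · ext x
    simpa using (h' 1 x).2

/-- `(z, 1)` is central, so its image commutes with everything, and its `H`-coordinate lies in the
trivial center of `H`. -/
theorem mulAut_apply_inl_snd (hH : Subgroup.center H = ⊥) (ψ : MulAut (Z × H)) (z : Z) :
    (ψ (z, 1)).2 = 1 := by
  have hc : (ψ (z, 1)).2 ∈ Subgroup.center H := by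
    rw [Subgroup.mem_center_iff]
    intro h
    have h1 : (z, (1 : H)) * ψ.symm (1, h) = ψ.symm (1, h) * (z, 1) := by
      ext <;> simp [mul_comm]
    have h2 := congrArg (fun p => (ψ p).2) h1
    simp only [map_mul, MulEquiv.apply_symm_apply, Prod.snd_mul] at h2
    exact h2.symm
  rwa [hH, Subgroup.mem_bot] at hc

/-- Both `ψ` and `ψ⁻¹` are block triangular, so the diagonal blocks of `ψ⁻¹` invert those of `ψ`. -/
theorem mulAut_eq_shear_mul_prodAut (hH : Subgroup.center H = ⊥) (ψ : MulAut (Z × H)) :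
    ∃ (f : H →* Z) (a : MulAut Z × MulAut H), ψ = shear f * prodAut Z H a := by
  have hZ : ∀ (χ : MulAut (Z × H)) z, χ (z, 1) = ((χ (z, 1)).1, 1) := fun χ z =>
    Prod.ext rfl (mulAut_apply_inl_snd hH χ z)
  have hsplit : ∀ (χ : MulAut (Z × H)) z h,
      χ (z, h) = ((χ (z, 1)).1 * (χ (1, h)).1, (χ (1, h)).2) := by
    intro χ z h
    have : ((z, h) : Z × H) = (z, 1) * (1, h) := by simp
    rw [this, map_mul, hZ χ z]
    ext <;> simp
  have hα : ∀ (χ ω : MulAut (Z × H)), (∀ p, χ (ω p) = p) → ∀ z, (χ ((ω (z, 1)).1, 1)).1 = z := by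
    intro χ ω h z
    rw [← hZ ω z, h]
  have hβ : ∀ (χ ω : MulAut (Z × H)), (∀ p, χ (ω p) = p) → ∀ x, (χ (1, (ω (1, x)).2)).2 = x := by
    intro χ ω h x
    have h1 := h (1, x)
    have h2 := hsplit χ (ω (1, x)).1 (ω (1, x)).2
    rw [Prod.mk.eta, h1] at h2
    exact (congrArg Prod.snd h2).symm
  let α : MulAut Z :=
    { toFun := fun z => (ψ (z, 1)).1
      invFun := fun z => (ψ.symm (z, 1)).1
      left_inv := hα ψ.symm ψ ψ.symm_apply_apply
      right_inv := hα ψ ψ.symm ψ.apply_symm_apply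
      map_mul' := fun z w => by
        rw [← Prod.fst_mul, ← map_mul, Prod.mk_mul_mk, mul_one] }
  let β : MulAut H :=
    { toFun := fun x => (ψ (1, x)).2
      invFun := fun x => (ψ.symm (1, x)).2
      left_inv := hβ ψ.symm ψ ψ.symm_apply_apply
      right_inv := hβ ψ ψ.symm ψ.apply_symm_apply
      map_mul' := fun x y => by
        rw [← Prod.snd_mul, ← map_mul, Prod.mk_mul_mk, mul_one] }
  let g : H →* Z := (MonoidHom.fst Z H).comp (ψ.toMonoidHom.comp (MonoidHom.inr Z H))
  -- The shear acts after `β`, so the off-diagonal block `g` must be precomposed with `β⁻¹`.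
  refine ⟨g.comp (β⁻¹ : MulAut H).toMonoidHom, (α, β), ?_⟩
  apply MulEquiv.ext
  rintro ⟨z, x⟩
  have h1 : (β⁻¹ : MulAut H) (β x) = x := MulAut.inv_apply_self _ _ _
  rw [hsplit, MulAut.mul_apply, prodAut_apply, shear_apply]
  change _ = (g ((β⁻¹ : MulAut H) (β x)) * α z, β x)
  rw [h1, mul_comm]
  rfl

end ProductAut

/-! ### Outer automorphisms of the product -/

section ProductOut

variable {A Z H : Type*} [Group A] [CommGroup Z] [Group H] (E : A ≃* Z × H)

theorem Out.mk_eq_one_iff {G : Type*} [Group G] (ψ : MulAut G) :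
    Out.mk G ψ = 1 ↔ ∃ g, MulAut.conj g = ψ :=
  QuotientGroup.eq_one_iff _

theorem Out.mk_surjective (G : Type*) [Group G] : Function.Surjective (Out.mk G) :=
  QuotientGroup.mk'_surjective _

theorem Out.mk_congr_eq_one_iff {G G' : Type*} [Group G] [Group G'] (e : G ≃* G') (ψ : MulAut G') :
    Out.mk G (MulAut.congr e.symm ψ) = 1 ↔ ∃ g, MulAut.conj g = ψ := by
  rw [Out.mk_eq_one_iff]
  constructor
  · rintro ⟨g, hg⟩
    refine ⟨e g, MulEquiv.ext fun x => ?_⟩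
    have := congrArg e (DFunLike.congr_fun hg (e.symm x))
    simpa [MulAut.congr] using this
  · rintro ⟨g, rfl⟩
    exact ⟨e.symm g, MulEquiv.ext fun x => by simp [MulAut.congr]⟩

/-- The outer automorphism of `A ≃ Z × H` given by a homomorphism `H → Z`. -/
def outShear : (H →* Z) →* Out A :=
  (Out.mk A).comp ((MulAut.congr E.symm).toMonoidHom.comp shear)

/-- The outer automorphism of `A ≃ Z × H` given by automorphisms of the factors. -/
def outProdAut {A Z H : Type*} [Group A] [Group Z] [Group H] (E : A ≃* Z × H) :
    MulAut Z × MulAut H →* Out A :=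
  (Out.mk A).comp ((MulAut.congr E.symm).toMonoidHom.comp (prodAut Z H))

/-- Gives both the injectivity of `outShear` and the injectivity of the map from the semidirect
product. -/
theorem outShear_mul_outProdAut_eq_one {f : H →* Z} {a : MulAut Z × MulAut H}
    (h : outShear E f * outProdAut E a = 1) : f = 1 ∧ a.1 = 1 ∧ Out.mk H a.2 = 1 := by
  have h' : Out.mk A (MulAut.congr E.symm (shear f * prodAut Z H a)) = 1 := by
    rw [map_mul, map_mul]
    exact h
  rw [Out.mk_congr_eq_one_iff] at h'
  obtain ⟨b, hb⟩ := h'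
  obtain ⟨h1, h2, h3⟩ := shear_mul_prodAut_eq_conj hb.symm
  exact ⟨h1, h2, (Out.mk_eq_one_iff _).2 ⟨_, h3.symm⟩⟩

theorem outShear_injective : Function.Injective (outShear E) := by
  rw [injective_iff_map_eq_one]
  intro f hf
  exact (outShear_mul_outProdAut_eq_one E (a := 1) (by rw [hf, map_one, one_mul])).1

theorem exists_eq_outShear_mul_outProdAut (hH : Subgroup.center H = ⊥) (o : Out A) :
    ∃ (f : H →* Z) (a : MulAut Z × MulAut H), o = outShear E f * outProdAut E a := by
  obtain ⟨ψ, rfl⟩ := Out.mk_surjective A o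
  obtain ⟨ω, rfl⟩ := (MulAut.congr E.symm).surjective ψ
  obtain ⟨f, a, rfl⟩ := mulAut_eq_shear_mul_prodAut hH ω
  exact ⟨f, a, by rw [map_mul, map_mul]; rfl⟩

theorem outProdAut_conj_outShear (a : MulAut Z × MulAut H) (f : H →* Z) :
    ∃ g, outProdAut E a * outShear E f * (outProdAut E a)⁻¹ = outShear E g := by
  have := congrArg (fun ω => Out.mk A (MulAut.congr E.symm ω)) (prodAut_conj_shear a f)
  simp only [map_mul, map_inv] at this
  exact ⟨_, this⟩

theorem outShear_range_normal (hH : Subgroup.center H = ⊥) : (outShear E).range.Normal where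
  conj_mem := by
    rintro _ ⟨f, rfl⟩ o
    obtain ⟨f', a, rfl⟩ := exists_eq_outShear_mul_outProdAut E hH o
    obtain ⟨g, hg⟩ := outProdAut_conj_outShear E a f
    refine ⟨f' * g * f'⁻¹, ?_⟩
    rw [map_mul, map_mul, ← hg, map_inv]
    group

theorem outProdAut_inner {A Z H : Type*} [Group A] [Group Z] [Group H] (E : A ≃* Z × H)
    {β : MulAut H} (hβ : β ∈ (MulAut.conj : H →* MulAut H).range) : outProdAut E (1, β) = 1 := by
  obtain ⟨h, rfl⟩ := hβ
  refine (Out.mk_congr_eq_one_iff E _).2 ⟨(1, h), ?_⟩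
  ext p <;> simp

/-- The homomorphism induced by `outProdAut` on outer automorphisms of `H`. -/
def outProdOut {A Z H : Type*} [Group A] [Group Z] [Group H] (E : A ≃* Z × H) :
    MulAut Z × Out H →* Out A :=
  MonoidHom.noncommCoprod ((outProdAut E).comp (MonoidHom.inl _ _))
    (QuotientGroup.lift _ ((outProdAut E).comp (MonoidHom.inr _ _)) fun _ h =>
      outProdAut_inner E h) (by
    intro α q
    obtain ⟨β, rfl⟩ := Out.mk_surjective H q
    change outProdAut E (α, 1) * outProdAut E (1, β) = outProdAut E (1, β) * outProdAut E (α, 1)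
    rw [← map_mul, ← map_mul]
    simp)

theorem outProdOut_mk {A Z H : Type*} [Group A] [Group Z] [Group H] (E : A ≃* Z × H)
    (α : MulAut Z) (β : MulAut H) : outProdOut E (α, Out.mk H β) = outProdAut E (α, β) := by
  change outProdAut E (α, 1) * outProdAut E (1, β) = _
  rw [← map_mul]
  simp

/-- The action is conjugation in `Out A`. Keeping `N` a variable equal to the range lets the result
apply to `Tr` itself. -/
theorem exists_out_equiv_semidirectProduct {A Z H : Type*} [Group A] [CommGroup Z] [Group H]
    (E : A ≃* Z × H) (hH : Subgroup.center H = ⊥)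
    {N : Subgroup (Out A)} (hN : N = (outShear E).range) :
    ∃ (φ : MulAut Z × Out H →* MulAut N) (e : N ⋊[φ] (MulAut Z × Out H) ≃* Out A),
      (∀ t : N, e (SemidirectProduct.inl t) = t) ∧
      ∀ a, e (SemidirectProduct.inr a) = outProdOut E a := by
  have hnormal : N.Normal := hN ▸ outShear_range_normal E hH
  let φ : MulAut Z × Out H →* MulAut N := MulAut.conjNormal.comp (outProdOut E)
  have hφ : ∀ a, N.subtype.comp (φ a).toMonoidHom =
      (MulAut.conj (outProdOut E a)).toMonoidHom.comp N.subtype := fun a => by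
    ext t
    simp [φ]
  let F : N ⋊[φ] (MulAut Z × Out H) →* Out A :=
    SemidirectProduct.lift N.subtype (outProdOut E) hφ
  have hF : Function.Bijective F := by
    constructor
    · rw [injective_iff_map_eq_one]
      rintro ⟨⟨t, ht⟩, α, q⟩ h
      obtain ⟨β, rfl⟩ := Out.mk_surjective H q
      have ht' := ht
      rw [hN] at ht'
      obtain ⟨f, rfl⟩ := ht'
      have h' : outShear E f * outProdAut E (α, β) = 1 := by
        rw [← outProdOut_mk]
        exact h
      obtain ⟨h1, h2, h3⟩ := outShear_mul_outProdAut_eq_one E h'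
      ext1
      · apply Subtype.ext
        simp [h1]
      · exact Prod.ext h2 h3
    · intro o
      obtain ⟨f, ⟨α, β⟩, rfl⟩ := exists_eq_outShear_mul_outProdAut E hH o
      refine ⟨⟨⟨outShear E f, hN ▸ ⟨f, rfl⟩⟩, (α, Out.mk H β)⟩, ?_⟩
      change outShear E f * outProdOut E _ = _
      rw [outProdOut_mk]
  refine ⟨φ, MulEquiv.ofBijective F hF, fun t => ?_, fun a => ?_⟩
  · exact SemidirectProduct.lift_inl N.subtype (outProdOut E) hφ t
  · exact SemidirectProduct.lift_inr N.subtype (outProdOut E) hφ a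

end ProductOut

/-! ### Free abelian groups -/

section FreeAbelian

/-- Surjectivity is automatic, since the image contains the standard basis. -/
theorem IsFreeAbelianOn.of_injective {ι G : Type*} [Group G] {b : ι → G}
    (χ : G →* Multiplicative (ι →₀ ℤ)) (hχ : Function.Injective χ)
    (hb : ∀ i, χ (b i) = Multiplicative.ofAdd (Finsupp.single i 1)) : IsFreeAbelianOn b := by
  have hsurj : Function.Surjective χ := by
    intro y
    induction y using Multiplicative.rec with
    | ofAdd y =>
    induction y using Finsupp.induction_linear with
    | zero => exact ⟨1, map_one χ⟩
    | add f g hf hg =>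
      obtain ⟨x, hx⟩ := hf
      obtain ⟨y, hy⟩ := hg
      exact ⟨x * y, by rw [map_mul, hx, hy, ofAdd_add]⟩
    | single i n =>
      refine ⟨b i ^ n, ?_⟩
      rw [map_zpow, hb, ← ofAdd_zsmul]
      simp
  exact ⟨MulEquiv.ofBijective χ ⟨hχ, hsurj⟩, hb⟩

theorem IsFreeAbelianOn.closure_eq_top {ι G : Type*} [Group G] {b : ι → G}
    (hb : IsFreeAbelianOn b) : Subgroup.closure (Set.range b) = ⊤ := by
  obtain ⟨e, he⟩ := hb
  rw [eq_top_iff]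
  rintro x -
  obtain ⟨y, rfl⟩ := e.symm.surjective x
  induction y using Multiplicative.rec with
  | ofAdd y =>
  induction y using Finsupp.induction_linear with
  | zero => rw [ofAdd_zero, map_one]; exact one_mem _
  | add f g hf hg => rw [ofAdd_add, map_mul]; exact mul_mem hf hg
  | single i n =>
    have : e.symm (Multiplicative.ofAdd (Finsupp.single i n)) = b i ^ n := by
      rw [MulEquiv.symm_apply_eq, map_zpow, he, ← ofAdd_zsmul]
      simp
    rw [this]
    exact zpow_mem (Subgroup.subset_closure (Set.mem_range_self i)) n

theorem IsFreeAbelianOn.closure_range_comp {ι G G' : Type*} [Group G] [Group G'] {b : ι → G}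
    (hb : IsFreeAbelianOn b) (F : G →* G') :
    Subgroup.closure (Set.range fun i => F (b i)) = F.range := by
  rw [MonoidHom.range_eq_map, ← hb.closure_eq_top, MonoidHom.map_closure, ← Set.range_comp]
  rfl

end FreeAbelian

/-! ### Cone vertices -/

namespace RAAG

variable {V : Type*} (Γ : SimpleGraph V)

theorem gen_mem_center {x : V} (hx : ∀ y, y ≠ x → Γ.Adj x y) :
    gen Γ x ∈ Subgroup.center (RAAG Γ) := by
  have hle : Subgroup.closure (Set.range (gen Γ)) ≤ Subgroup.centralizer {gen Γ x} := by
    refine (Subgroup.closure_le _).2 ?_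
    rintro _ ⟨y, rfl⟩
    refine Subgroup.mem_centralizer_singleton_iff.2 ?_
    by_cases hy : y = x
    · rw [hy]
    · exact gen_commute Γ (hx y hy).symm
  rw [closure_range_gen] at hle
  exact Subgroup.mem_center_iff.2 fun g =>
    Subgroup.mem_centralizer_singleton_iff.1 (hle (Subgroup.mem_top g))

theorem incl_mem_center {C : Set V} (hC : ∀ w ∈ C, ∀ u, u ≠ w → Γ.Adj w u)
    (x : RAAG (Γ.induce C)) : incl Γ C x ∈ Subgroup.center (RAAG Γ) := by
  have hle : Subgroup.closure (Set.range (gen (Γ.induce C))) ≤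
      (Subgroup.center (RAAG Γ)).comap (incl Γ C) := by
    refine (Subgroup.closure_le _).2 ?_
    rintro _ ⟨w, rfl⟩
    change incl Γ C (gen _ w) ∈ Subgroup.center (RAAG Γ)
    rw [incl, lift_gen]
    exact gen_mem_center Γ (hC w w.2)
  rw [closure_range_gen] at hle
  exact hle (Subgroup.mem_top x)

/-- The right-angled Artin group of a complete graph is commutative. -/
@[reducible]
def commGroupOfComplete {Γ : SimpleGraph V} (h : ∀ u w, u ≠ w → Γ.Adj u w) : CommGroup (RAAG Γ) :=
  { (inferInstance : Group (RAAG Γ)) with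
    mul_comm := by
      have hle : Subgroup.closure (Set.range (gen Γ)) ≤ Subgroup.center (RAAG Γ) := by
        refine (Subgroup.closure_le _).2 ?_
        rintro _ ⟨x, rfl⟩
        exact gen_mem_center Γ fun y hy => h x y hy.symm
      rw [closure_range_gen] at hle
      exact fun a b => Subgroup.mem_center_iff.1 (hle (Subgroup.mem_top b)) a }

theorem isFreeAbelianOn_gen {Γ : SimpleGraph V} (h : ∀ u w, u ≠ w → Γ.Adj u w) :
    IsFreeAbelianOn (gen Γ) := by
  let := commGroupOfComplete h
  refine IsFreeAbelianOn.of_injective (exponents Γ) ?_ (exponents_gen Γ)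
  -- Commutativity allows a map back from the exponent vectors; it is a left inverse of `exponents`.
  let θ : (V →₀ ℤ) →+ Additive (RAAG Γ) :=
    Finsupp.liftAddHom fun v => zmultiplesHom _ (Additive.ofMul (gen Γ v))
  have hθ : (AddMonoidHom.toMultiplicativeLeft θ).comp (exponents Γ) = MonoidHom.id _ := by
    apply hom_ext
    intro v
    rw [MonoidHom.comp_apply, exponents_gen]
    change (θ (Finsupp.single v 1)).toMul = _
    simp [θ]
  exact Function.LeftInverse.injective (g := AddMonoidHom.toMultiplicativeLeft θ)
    fun x => DFunLike.congr_fun hθ x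

open Classical in
/-- The homomorphism to a commutative group that sends `u` to `z` and kills all other vertices. -/
noncomputable def elementaryHom {Z : Type*} [CommGroup Z] (u : V) (z : Z) : RAAG Γ →* Z :=
  lift (fun x => if x = u then z else 1) fun _ _ _ => mul_comm _ _

theorem elementaryHom_gen_self {Z : Type*} [CommGroup Z] (u : V) (z : Z) :
    elementaryHom Γ u z (gen Γ u) = z := by
  simp [elementaryHom]

theorem elementaryHom_gen_of_ne {Z : Type*} [CommGroup Z] {u x : V} (h : x ≠ u) (z : Z) :
    elementaryHom Γ u z (gen Γ x) = 1 := by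
  simp [elementaryHom, h]

/-- A homomorphism to `Z` is determined by the integer matrix of coordinates of the images of the
vertices; elementary homomorphisms are the matrix units. -/
theorem isFreeAbelianOn_elementaryHom {ι Z : Type*} [Finite V] [Finite ι] [CommGroup Z]
    {b : ι → Z} (hb : IsFreeAbelianOn b) :
    IsFreeAbelianOn fun p : V × ι => elementaryHom Γ p.1 (b p.2) := by
  classical
  obtain ⟨e, he⟩ := hb
  let χ : (RAAG Γ →* Z) →* Multiplicative (V × ι →₀ ℤ) :=
    { toFun := fun f => Multiplicative.ofAdd <| Finsupp.equivFunOnFinite.symm fun p =>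
        (e (f (gen Γ p.1))).toAdd p.2
      map_one' := by
        apply Multiplicative.toAdd.injective
        ext p
        simp
      map_mul' := fun f g => by
        apply Multiplicative.toAdd.injective
        ext p
        simp }
  have hχ : ∀ f p, (χ f).toAdd p = (e (f (gen Γ p.1))).toAdd p.2 := fun _ _ => rfl
  refine IsFreeAbelianOn.of_injective χ ?_ ?_
  · intro f g hfg
    apply hom_ext
    intro v
    apply e.injective
    apply Multiplicative.toAdd.injective
    ext i
    rw [← hχ f (v, i), ← hχ g (v, i), hfg]
  · rintro ⟨u, i⟩
    apply Multiplicative.toAdd.injective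
    ext ⟨x, j⟩
    rw [hχ, toAdd_ofAdd]
    by_cases hx : x = u
    · subst hx
      rw [elementaryHom_gen_self, he, toAdd_ofAdd]
      simp [Finsupp.single_apply]
    · rw [elementaryHom_gen_of_ne Γ hx, map_one]
      simp [Ne.symm hx]

open Classical in
/-- The retraction of `A_Γ` onto `A_S` that kills the vertices outside `S`. -/
noncomputable def proj (S : Set V) : RAAG Γ →* RAAG (Γ.induce S) :=
  lift (fun v => if h : v ∈ S then gen (Γ.induce S) ⟨v, h⟩ else 1) fun u w h => by
    by_cases hu : u ∈ S <;> by_cases hw : w ∈ S <;> simp only [hu, hw, dite_true, dite_false,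
      one_mul, mul_one]
    exact gen_commute (Γ.induce S) (u := ⟨u, hu⟩) (w := ⟨w, hw⟩) h

theorem proj_gen_of_mem {S : Set V} {v : V} (h : v ∈ S) :
    proj Γ S (gen Γ v) = gen (Γ.induce S) ⟨v, h⟩ := by
  simp [proj, h]

theorem proj_gen_of_notMem {S : Set V} {v : V} (h : v ∉ S) : proj Γ S (gen Γ v) = 1 := by
  simp [proj, h]

@[simp]
theorem incl_gen (S : Set V) (v : S) : incl Γ S (gen (Γ.induce S) v) = gen Γ v := by
  simp [incl]

theorem proj_comp_incl (S : Set V) : (proj Γ S).comp (incl Γ S) = MonoidHom.id _ :=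
  hom_ext fun v => by
    rw [MonoidHom.comp_apply, incl_gen, proj_gen_of_mem Γ v.2, MonoidHom.id_apply]

theorem proj_comp_incl_of_disjoint {S T : Set V} (h : Disjoint S T) :
    (proj Γ S).comp (incl Γ T) = 1 :=
  hom_ext fun v => by
    rw [MonoidHom.comp_apply, incl_gen, proj_gen_of_notMem Γ (h.notMem_of_mem_right v.2),
      MonoidHom.one_apply]

/-- If `C` consists of cone vertices and `L` is its complement, then `A_Γ = A_C × A_L`. -/
noncomputable def coneEquiv {C L : Set V} (hC : ∀ w ∈ C, ∀ u, u ≠ w → Γ.Adj w u)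
    (hL : IsCompl C L) : RAAG Γ ≃* RAAG (Γ.induce C) × RAAG (Γ.induce L) :=
  MonoidHom.toMulEquiv ((proj Γ C).prod (proj Γ L))
    (MonoidHom.noncommCoprod (incl Γ C) (incl Γ L) fun x y =>
      Commute.symm (Subgroup.mem_center_iff.1 (incl_mem_center Γ hC x) (incl Γ L y)))
    (by
      apply hom_ext
      intro v
      rw [MonoidHom.comp_apply, MonoidHom.prod_apply, MonoidHom.noncommCoprod_apply,
        MonoidHom.id_apply]
      rcases hL.codisjoint.top_le (Set.mem_univ v) with h | h
      · rw [proj_gen_of_mem Γ h, proj_gen_of_notMem Γ (hL.disjoint.notMem_of_mem_left h),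
          map_one, mul_one, incl_gen]
      · rw [proj_gen_of_mem Γ h, proj_gen_of_notMem Γ (hL.disjoint.notMem_of_mem_right h),
          map_one, one_mul, incl_gen])
    (by
      have h1 := fun x => DFunLike.congr_fun (proj_comp_incl Γ C) x
      have h2 := fun x => DFunLike.congr_fun (proj_comp_incl Γ L) x
      have h3 := fun x => DFunLike.congr_fun (proj_comp_incl_of_disjoint Γ hL.disjoint) x
      have h4 := fun x => DFunLike.congr_fun (proj_comp_incl_of_disjoint Γ hL.disjoint.symm) x
      simp only [MonoidHom.comp_apply, MonoidHom.id_apply, MonoidHom.one_apply] at h1 h2 h3 h4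
      ext p <;> simp [h1, h2, h3, h4])

section

variable {C L : Set V} (hC : ∀ w ∈ C, ∀ u, u ≠ w → Γ.Adj w u) (hL : IsCompl C L)

theorem coneEquiv_symm_apply (p : RAAG (Γ.induce C) × RAAG (Γ.induce L)) :
    (coneEquiv Γ hC hL).symm p = incl Γ C p.1 * incl Γ L p.2 := rfl

theorem coneEquiv_incl_left (x : RAAG (Γ.induce C)) :
    coneEquiv Γ hC hL (incl Γ C x) = (x, 1) := by
  rw [← MulEquiv.eq_symm_apply, coneEquiv_symm_apply, map_one, mul_one]

theorem coneEquiv_incl_right (y : RAAG (Γ.induce L)) :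
    coneEquiv Γ hC hL (incl Γ L y) = (1, y) := by
  rw [← MulEquiv.eq_symm_apply, coneEquiv_symm_apply, map_one, one_mul]

end

end RAAG

/-! ### Cone vertices as the unique vertex of `Γ₀`, and the transvections as shears -/

section GammaZero

variable {V : Type*} {Γ : SimpleGraph V}

/-- By connectedness `u` has a neighbour `x`, and `x ≤ w` gives `u ∈ lk(x) ⊆ st(w)`. -/
theorem adj_of_gammaZero [Finite V] (hΓ : Γ.Connected) {v : V}
    (hv : gammaZeroVertices Γ = {vertexClass Γ v}) :
    ∀ w ∈ classSet Γ v, ∀ u, u ≠ w → Γ.Adj w u := by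
  intro w hw u hu
  obtain ⟨x, hx⟩ : ∃ x, Γ.Adj u x := by
    have : Nontrivial V := ⟨u, w, hu⟩
    exact hΓ.preconnected.exists_adj_of_nontrivial u
  rcases domLE_of_gammaZero Γ hv x hw hx.symm with h | h
  · exact absurd h hu
  · exact h

/-- The star of a cone vertex is everything, so its class is the greatest one. -/
theorem gammaZero_eq_of_cone {v : V} (hv : ∀ u, u ≠ v → Γ.Adj v u) :
    gammaZeroVertices Γ = {vertexClass Γ v} := by
  have hle : ∀ c : VertexClass Γ, c ≤ vertexClass Γ v := by
    rintro ⟨u⟩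
    intro x _
    by_cases hx : x = v
    · exact Or.inl hx
    · exact Or.inr (hv x hx)
  ext c
  rw [Set.mem_singleton_iff]
  constructor
  · intro hc
    exact le_antisymm (hle c) (hc (hle c))
  · rintro rfl b _
    exact hle b

theorem exists_gammaZero_iff [Finite V] (hΓ : Γ.Connected) :
    (∃ v : V, gammaZeroVertices Γ = {vertexClass Γ v}) ↔ Subgroup.center (RAAG Γ) ≠ ⊥ := by
  constructor
  · rintro ⟨v, hv⟩ h
    have hc := RAAG.gen_mem_center Γ (adj_of_gammaZero hΓ hv v rfl)
    rw [h, Subgroup.mem_bot] at hc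
    exact RAAG.gen_ne_one Γ v hc
  · intro h
    by_contra hne
    refine h (RAAG.center_eq_bot Γ fun x => ?_)
    by_contra hx
    push Not at hx
    exact hne ⟨x, gammaZero_eq_of_cone hx⟩

variable [Finite V] {v : V}

theorem isCompl_classSet_linkSet (hΓ : Γ.Connected)
    (hv : gammaZeroVertices Γ = {vertexClass Γ v}) : IsCompl (classSet Γ v) (linkSet Γ v) := by
  refine ⟨Set.disjoint_sdiff_right, ?_⟩
  rw [codisjoint_iff_le_sup]
  intro u _
  by_cases hu : u ∈ classSet Γ v
  · exact Or.inl hu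
  · refine Or.inr ⟨adj_of_gammaZero hΓ hv v rfl u ?_, hu⟩
    rintro rfl
    exact hu rfl

/-- A cone vertex of the graph on `L` is also adjacent to all of `[v]`. It would then be a cone
vertex of `Γ`, and its class would be `[v]`, which `L` avoids. -/
theorem center_linkSet_eq_bot (hΓ : Γ.Connected)
    (hv : gammaZeroVertices Γ = {vertexClass Γ v}) :
    Subgroup.center (RAAG (Γ.induce (linkSet Γ v))) = ⊥ := by
  refine RAAG.center_eq_bot _ fun x => ?_
  by_contra hx
  push Not at hx
  have hcone : ∀ u, u ≠ (x : V) → Γ.Adj x u := by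
    intro u hu
    rcases (isCompl_classSet_linkSet hΓ hv).codisjoint.top_le (Set.mem_univ u) with h | h
    · exact (adj_of_gammaZero hΓ hv u h x hu.symm).symm
    · exact hx ⟨u, h⟩ fun h' => hu (congrArg Subtype.val h')
  have h := gammaZero_eq_of_cone hcone
  rw [hv, Set.singleton_eq_singleton_iff] at h
  exact x.2.2 h.symm

theorem adj_classSet (hΓ : Γ.Connected) (hv : gammaZeroVertices Γ = {vertexClass Γ v})
    (u w : classSet Γ v) (h : u ≠ w) : (Γ.induce (classSet Γ v)).Adj u w :=
  adj_of_gammaZero hΓ hv u u.2 w fun h' => h (Subtype.ext h'.symm)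

/-- The decomposition `A_Γ = A_[v] × A_L`. -/
noncomputable def gammaZeroEquiv (hΓ : Γ.Connected)
    (hv : gammaZeroVertices Γ = {vertexClass Γ v}) :
    RAAG Γ ≃* RAAG (Γ.induce (classSet Γ v)) × RAAG (Γ.induce (linkSet Γ v)) :=
  RAAG.coneEquiv Γ (adj_of_gammaZero hΓ hv) (isCompl_classSet_linkSet hΓ hv)

theorem leafTransvection_eq_outShear (hΓ : Γ.Connected)
    (hv : gammaZeroVertices Γ = {vertexClass Γ v}) (p : linkSet Γ v × classSet Γ v) :
    letI := RAAG.commGroupOfComplete (adj_classSet hΓ hv)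
    leafTransvection hv p = outShear (gammaZeroEquiv hΓ hv)
      (RAAG.elementaryHom _ p.1 (RAAG.gen (Γ.induce (classSet Γ v)) p.2)) := by
  let := RAAG.commGroupOfComplete (adj_classSet hΓ hv)
  refine congrArg (Out.mk _) (MulEquiv.toMonoidHom_injective (RAAG.hom_ext fun x => ?_))
  change transvection _ _ (RAAG.gen Γ x) = (gammaZeroEquiv hΓ hv).symm
    (shear _ (gammaZeroEquiv hΓ hv (RAAG.gen Γ x)))
  rcases (isCompl_classSet_linkSet hΓ hv).codisjoint.top_le (Set.mem_univ x) with h | h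
  · have hx : x ≠ p.1 := fun h' => p.1.2.2 (h' ▸ h)
    have hE := RAAG.coneEquiv_incl_left Γ (adj_of_gammaZero hΓ hv)
      (isCompl_classSet_linkSet hΓ hv) (RAAG.gen _ ⟨x, h⟩)
    rw [RAAG.incl_gen] at hE
    rw [transvection_gen_of_ne _ _ hx, gammaZeroEquiv, hE, RAAG.coneEquiv_symm_apply]
    simp
  · have hE := RAAG.coneEquiv_incl_right Γ (adj_of_gammaZero hΓ hv)
      (isCompl_classSet_linkSet hΓ hv) (RAAG.gen _ ⟨x, h⟩)
    rw [RAAG.incl_gen] at hE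
    rw [gammaZeroEquiv, hE, RAAG.coneEquiv_symm_apply]
    by_cases hx : x = p.1
    · obtain ⟨⟨u, hu⟩, w⟩ := p
      subst hx
      rw [transvection_gen_self, shear_apply, mul_one, RAAG.elementaryHom_gen_self,
        RAAG.incl_gen, RAAG.incl_gen]
      -- The shear yields `w u` and the transvection `u w`; these agree because `w` is central.
      refine Subgroup.mem_center_iff.1 (RAAG.gen_mem_center Γ ?_) _
      exact adj_of_gammaZero hΓ hv w w.2
    · have hx' : (⟨x, h⟩ : linkSet Γ v) ≠ p.1 := fun h' => hx (congrArg Subtype.val h')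
      rw [transvection_gen_of_ne _ _ hx, shear_apply, mul_one,
        RAAG.elementaryHom_gen_of_ne _ hx', map_one, one_mul, RAAG.incl_gen]

/-- The elementary homomorphisms generate `Hom(A_L, A_[v])`, so their images, the transvections,
generate the range. -/
theorem Tr_eq_range (hΓ : Γ.Connected) (hv : gammaZeroVertices Γ = {vertexClass Γ v}) :
    letI := RAAG.commGroupOfComplete (adj_classSet hΓ hv)
    Tr hv = (outShear (gammaZeroEquiv hΓ hv)).range := by
  let := RAAG.commGroupOfComplete (adj_classSet hΓ hv)
  have hfree := RAAG.isFreeAbelianOn_elementaryHom (Γ.induce (linkSet Γ v))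
    (RAAG.isFreeAbelianOn_gen (adj_classSet hΓ hv))
  rw [← hfree.closure_range_comp, Tr]
  congr 2
  funext p
  exact leafTransvection_eq_outShear hΓ hv p

theorem isFreeAbelianOn_Tr_gen (hΓ : Γ.Connected)
    (hv : gammaZeroVertices Γ = {vertexClass Γ v}) : IsFreeAbelianOn (Tr.gen hv) := by
  let := RAAG.commGroupOfComplete (adj_classSet hΓ hv)
  obtain ⟨e, he⟩ := RAAG.isFreeAbelianOn_elementaryHom (Γ.induce (linkSet Γ v))
    (RAAG.isFreeAbelianOn_gen (adj_classSet hΓ hv))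
  let F := MonoidHom.ofInjective (outShear_injective (gammaZeroEquiv hΓ hv))
  let G := MulEquiv.subgroupCongr (Tr_eq_range hΓ hv)
  refine ⟨(G.trans F.symm).trans e, fun p => ?_⟩
  rw [← he p]
  refine congrArg e (F.symm_apply_eq.2 (Subtype.ext ?_))
  exact leafTransvection_eq_outShear hΓ hv p

end GammaZero

theorem mainTheorem4 {V : Type*} [Finite V] (Γ : SimpleGraph V) (hΓ : Γ.Connected) :
    -- `Γ₀` is a single vertex if and only if `A_Γ` has nontrivial center
    ((∃ v : V, gammaZeroVertices Γ = {vertexClass Γ v}) ↔ Subgroup.center (RAAG Γ) ≠ ⊥) ∧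
    ∀ (v : V) (hv : gammaZeroVertices Γ = {vertexClass Γ v}),
      -- `A_[v]` is free abelian on `[v]`, so that `Aut(A_[v]) = GL(A_[v])`
      IsFreeAbelianOn (RAAG.gen (Γ.induce (classSet Γ v))) ∧
      -- `Tr` is free abelian on the transvections `t(u,w)`, `u ∈ L_[v]`, `w ∈ [v]`
      IsFreeAbelianOn (Tr.gen hv) ∧
      -- `Out(A_Γ) = Tr ⋊ (GL(A_[v]) × Out(A_{L_[v]}))`
      ∃ (φ : MulAut (RAAG (Γ.induce (classSet Γ v))) × Out (RAAG (Γ.induce (linkSet Γ v))) →*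
            MulAut (Tr hv))
        (e : (Tr hv) ⋊[φ]
            (MulAut (RAAG (Γ.induce (classSet Γ v))) × Out (RAAG (Γ.induce (linkSet Γ v)))) ≃*
            Out (RAAG Γ)),
        (∀ t : Tr hv, e (SemidirectProduct.inl t) = t) ∧
        ∀ (α : MulAut (RAAG (Γ.induce (classSet Γ v))))
          (β : MulAut (RAAG (Γ.induce (linkSet Γ v)))),
          ∃ ψ : MulAut (RAAG Γ),
            (∀ x, ψ (RAAG.incl Γ (classSet Γ v) x) = RAAG.incl Γ (classSet Γ v) (α x)) ∧
            (∀ y, ψ (RAAG.incl Γ (linkSet Γ v) y) = RAAG.incl Γ (linkSet Γ v) (β y)) ∧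
            e (SemidirectProduct.inr (α, Out.mk _ β)) = Out.mk _ ψ := by
  refine ⟨exists_gammaZero_iff hΓ, fun v hv => ⟨RAAG.isFreeAbelianOn_gen (adj_classSet hΓ hv),
    isFreeAbelianOn_Tr_gen hΓ hv, ?_⟩⟩
  let := RAAG.commGroupOfComplete (adj_classSet hΓ hv)
  let E := gammaZeroEquiv hΓ hv
  obtain ⟨φ, e, h1, h2⟩ := exists_out_equiv_semidirectProduct E (center_linkSet_eq_bot hΓ hv)
    (Tr_eq_range hΓ hv)
  -- The representative is `α × β`, transported along `A_Γ ≃ A_[v] × A_L`.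
  refine ⟨φ, e, h1, fun α β => ⟨MulAut.congr E.symm (prodAut _ _ (α, β)), fun x => ?_, fun y => ?_,
    ?_⟩⟩
  · change E.symm (prodAut _ _ (α, β) (E (RAAG.incl Γ _ x))) = _
    rw [show E (RAAG.incl Γ _ x) = (x, 1) from RAAG.coneEquiv_incl_left Γ _ _ x,
      prodAut_apply, map_one, MulEquiv.symm_apply_eq]
    exact (RAAG.coneEquiv_incl_left Γ _ _ _).symm
  · change E.symm (prodAut _ _ (α, β) (E (RAAG.incl Γ _ y))) = _
    rw [show E (RAAG.incl Γ _ y) = (1, y) from RAAG.coneEquiv_incl_right Γ _ _ y,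
      prodAut_apply, map_one, MulEquiv.symm_apply_eq]
    exact (RAAG.coneEquiv_incl_right Γ _ _ _).symm
  · rw [h2, outProdOut_mk]
    rfl
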